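/- **Setting.** Let $\Theta\subset\mathbb R^k$ be open, let $H$ be a measurable (nuisance) space, and let $\{P_{\theta,\eta}:\theta\in\Theta,\ \eta\in H\}$ be a model of probability distributions on a sample space, dominated by a $\sigma$-finite measure with densities $p_{\theta,\eta}(x)$ that are jointly measurable in $(\theta,\eta,x)$. Fix $\theta_0\in\Theta$, $\eta_0\in H$, and let $X_1,X_2,\ldots$ be i.i.d. with distribution $P_0=P_{\theta_0,\eta_0}$. Let $\Pi_\Theta$ and $\Pi_H$ be probability measures on $\Theta$ and $H$; the prior is the product $\Pi_\Theta\times\Pi_H$, and the posterior is given by Bayes' rule, $$\Pi_n(C\mid X_1,\ldots,X_n)=\frac{\int_C\prod_{i=1}^np_{\theta,\eta}(X_i)\,d(\Pi_\Theta\times\Pi_H)(\theta,\eta)}{\int_{\Theta\times H}\prod_{i=1}^np_{\theta,\eta}(X_i)\,d(\Pi_\Theta\times\Pi_H)(\theta,\eta)} .$$ Write $h=\sqrt n(\theta-\theta_0)$ for the local parameter, so that $\Pi_n(h\in A\mid X_1,\ldots,X_n)$ denotes its marginal posterior, and set $$s_n(h)=\int_H\prod_{i=1}^n\frac{p_{\theta_0+n^{-1/2}h,\eta}}{p_{\theta_0,\eta_0}}(X_i)\,d\Pi_H(\eta),\qquad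 \theta_0+n^{-1/2}h\in\Theta .$$ **Theorem 5.1 (Posterior asymptotic normality).** Suppose that $\Pi_\Theta$ is thick at $\theta_0$, i.e. it has a Lebesgue density that is continuous and strictly positive at $\theta_0$, and that for large enough $n$ the map $h\mapsto s_n(h)$ is continuous $P_0^n$-almost surely. Assume that there is a function $\tilde\ell\in L_2(P_0)$ with values in $\mathbb R^k$ such that $P_0\tilde\ell=0$, the matrix $\tilde I=P_0(\tilde\ell\,\tilde\ell^{\,T})$ is non-singular, and, for every sequence of random vectors $h_n=h_n(X_1,\ldots,X_n)\in\mathbb R^k$ that is bounded in $P_0$-probability, $$\log\frac{s_n(h_n)}{s_n(0)}=\frac1{\sqrt n}\sum_{i=1}^nh_n^T\tilde\ell(X_i)-\tfrac12\,h_n^T\tilde I\,h_n+o_{P_0}(1).$$ Suppose furthermore that for every sequence $M_n\to\infty$, $$\Pi_n\bigl(\|h\|\le M_n\mid X_1,\ldots,X_n\bigr)\to1\quad\text{in }P_0\text{-probability}.$$ Then, with $\tilde\Delta_n=n^{-1/2}\sum_{i=1}^n\tilde I^{-1}\tilde\ell(X_i)$ and $N_{\mu,\Sigma}$ the normal distribution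 with mean $\mu$ and covariance matrix $\Sigma$, $$\sup_A\Bigl|\,\Pi_n\bigl(h\in A\mid X_1,\ldots,X_n\bigr)-N_{\tilde\Delta_n,\tilde I^{-1}}(A)\Bigr|\to0\quad\text{in }P_0\text{-probability},$$ where the supremum is over all Borel sets $A\subset\mathbb R^k$. -/

import Mathlib

open MeasureTheory ProbabilityTheory Filter Topology
open scoped ENNReal

/-- A semiparametric model `{P_{θ,η} : θ ∈ Θ, η ∈ H}`: `Θ` is an open subset of `ℝ^k`, `H` is an
arbitrary (measurable) nuisance space, and the model is dominated by a `σ`-finite measure `μ` with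
jointly measurable probability densities `p θ η`. Values of `p θ η` with `θ ∉ Θ` carry no meaning.
-/
structure SemiparametricModel (k : ℕ) (H X : Type*) [MeasurableSpace H] [MeasurableSpace X] where
  Θ : Set (EuclideanSpace ℝ (Fin k))
  isOpen_Θ : IsOpen Θ
  μ : Measure X
  sigmaFinite_μ : SigmaFinite μ
  p : EuclideanSpace ℝ (Fin k) → H → X → ℝ≥0∞
  measurable_p : Measurable fun z : EuclideanSpace ℝ (Fin k) × H × X => p z.1 z.2.1 z.2.2
  lintegral_p : ∀ θ ∈ Θ, ∀ η, ∫⁻ x, p θ η x ∂μ = 1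

namespace SemiparametricModel

noncomputable section

variable {k : ℕ} {H X : Type*} [MeasurableSpace H] [MeasurableSpace X]

/-- The model distribution `P_{θ,η}` of one observation. -/
def P (M : SemiparametricModel k H X) (θ : EuclideanSpace ℝ (Fin k)) (η : H) : Measure X :=
  M.μ.withDensity (M.p θ η)

/-- The likelihood `∏ᵢ p_{θ,η}(Xᵢ)` of a sample of size `n`. -/
def likelihood (M : SemiparametricModel k H X) (θ : EuclideanSpace ℝ (Fin k)) (η : H)
    {n : ℕ} (x : Fin n → X) : ℝ≥0∞ :=
  ∏ i, M.p θ η (x i)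

/-- The integrated likelihood ratio
`S_n(θ) = ∫_H ∏ᵢ (p_{θ,η} / p_{θ₀,η₀})(Xᵢ) dΠ_H(η)`, with values in `[0, ∞]`. -/
def integratedLR (M : SemiparametricModel k H X) (θ₀ : EuclideanSpace ℝ (Fin k)) (η₀ : H)
    (PiH : Measure H) {n : ℕ} (x : Fin n → X) (θ : EuclideanSpace ℝ (Fin k)) : ℝ≥0∞ :=
  ∫⁻ η, ∏ i, M.p θ η (x i) / M.p θ₀ η₀ (x i) ∂PiH

/-- The localized integrated likelihood ratio `s_n(h) = S_n(θ₀ + n^{-1/2} h)`. -/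
def localLR (M : SemiparametricModel k H X) (θ₀ : EuclideanSpace ℝ (Fin k)) (η₀ : H)
    (PiH : Measure H) {n : ℕ} (x : Fin n → X) (h : EuclideanSpace ℝ (Fin k)) : ℝ≥0∞ :=
  M.integratedLR θ₀ η₀ PiH x (θ₀ + (√(n : ℝ))⁻¹ • h)

/-- The posterior for `(θ, η)` given the sample `x`, for the product prior `Π_Θ × Π_H`, by Bayes'
rule. (It is the zero measure if the normalizing constant is `0` or `∞`.) -/
def posterior (M : SemiparametricModel k H X) (PiΘ : Measure (EuclideanSpace ℝ (Fin k)))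
    (PiH : Measure H) {n : ℕ} (x : Fin n → X) : Measure (EuclideanSpace ℝ (Fin k) × H) :=
  (∫⁻ z, M.likelihood z.1 z.2 x ∂(PiΘ.prod PiH))⁻¹ •
    (PiΘ.prod PiH).withDensity fun z => M.likelihood z.1 z.2 x

/-- The marginal posterior of the local parameter `h = √n (θ - θ₀)` given the sample `x`. -/
def localPosterior (M : SemiparametricModel k H X) (θ₀ : EuclideanSpace ℝ (Fin k))
    (PiΘ : Measure (EuclideanSpace ℝ (Fin k))) (PiH : Measure H) {n : ℕ} (x : Fin n → X) :
    Measure (EuclideanSpace ℝ (Fin k)) :=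
  (M.posterior PiΘ PiH x).map fun z => √(n : ℝ) • (z.1 - θ₀)

end

end SemiparametricModel

noncomputable section

/-- The law `Q^n` of an i.i.d. sample of size `n` from `Q`. -/
def sampleLaw {X : Type*} [MeasurableSpace X] (Q : Measure X) (n : ℕ) : Measure (Fin n → X) :=
  Measure.pi fun _ => Q

/-- Convergence in `Q`-probability to the constant `c` of real statistics `Y_n(X₁, …, X_n)`. -/
def ConvergesInProb {X : Type*} [MeasurableSpace X] (Q : Measure X)
    (Y : (n : ℕ) → (Fin n → X) → ℝ) (c : ℝ) : Prop :=
  ∀ ε : ℝ, 0 < ε → Tendsto (fun n => sampleLaw Q n {x | ε < |Y n x - c|}) atTop (𝓝 0)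

/-- `h_n = O_Q(1)`: the sequence of statistics `h_n(X₁, …, X_n)` is bounded in `Q`-probability. -/
def BoundedInProb {k : ℕ} {X : Type*} [MeasurableSpace X] (Q : Measure X)
    (h : (n : ℕ) → (Fin n → X) → EuclideanSpace ℝ (Fin k)) : Prop :=
  ∀ ε : ℝ≥0∞, 0 < ε → ∃ C : ℝ, ∀ n, sampleLaw Q n {x | C < ‖h n x‖} ≤ ε

/-- `Π_Θ` is thick at `θ₀`: it has a Lebesgue density that is continuous and strictly positive at
`θ₀`. -/
def ThickAt {k : ℕ} (PiΘ : Measure (EuclideanSpace ℝ (Fin k)))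
    (θ₀ : EuclideanSpace ℝ (Fin k)) : Prop :=
  ∃ f : EuclideanSpace ℝ (Fin k) → ℝ, Measurable f ∧ (∀ θ, 0 ≤ f θ) ∧
    PiΘ = volume.withDensity (fun θ => ENNReal.ofReal (f θ)) ∧ ContinuousAt f θ₀ ∧ 0 < f θ₀

/-- The information matrix `Ĩ = Q(ℓ ℓᵀ)` of a score `ℓ`. -/
def infoMatrix {k : ℕ} {X : Type*} [MeasurableSpace X] (Q : Measure X)
    (l : X → EuclideanSpace ℝ (Fin k)) : Matrix (Fin k) (Fin k) ℝ :=
  Matrix.of fun i j => ∫ x, l x i * l x j ∂Q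

/-- The centring `Δ̃_n = n^{-1/2} ∑ᵢ Ĩ⁻¹ ℓ(Xᵢ)`. -/
def centring {k : ℕ} {X : Type*} [MeasurableSpace X] (Q : Measure X)
    (l : X → EuclideanSpace ℝ (Fin k)) {n : ℕ} (x : Fin n → X) : EuclideanSpace ℝ (Fin k) :=
  (√(n : ℝ))⁻¹ • ∑ i, WithLp.toLp 2 ((infoMatrix Q l)⁻¹.mulVec (l (x i)).ofLp)

/-- The integral LAN property with score `ℓ` under `P₀ = P_{θ₀,η₀}`: for every `h_n = O_{P₀}(1)`,
`log (s_n(h_n) / s_n(0)) = n^{-1/2} ∑ᵢ h_nᵀ ℓ(Xᵢ) - ½ h_nᵀ Ĩ h_n + o_{P₀}(1)`.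
The expansion entails that `s_n(0)` and `s_n(h_n)` lie in `(0, ∞)` with probability tending to
one; this is made explicit because `Real.log` and `ENNReal.toReal` take conventional values
elsewhere. -/
def SemiparametricModel.HasILAN {k : ℕ} {H X : Type*} [MeasurableSpace H] [MeasurableSpace X]
    (M : SemiparametricModel k H X) (θ₀ : EuclideanSpace ℝ (Fin k)) (η₀ : H) (PiH : Measure H)
    (l : X → EuclideanSpace ℝ (Fin k)) : Prop :=
  ∀ h : (n : ℕ) → (Fin n → X) → EuclideanSpace ℝ (Fin k), (∀ n, Measurable (h n)) →
    BoundedInProb (M.P θ₀ η₀) h → ∀ ε : ℝ, 0 < ε →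
      Tendsto (fun n => sampleLaw (M.P θ₀ η₀) n {x | ¬
        (0 < M.localLR θ₀ η₀ PiH x 0 ∧ M.localLR θ₀ η₀ PiH x 0 < ∞ ∧
          0 < M.localLR θ₀ η₀ PiH x (h n x) ∧ M.localLR θ₀ η₀ PiH x (h n x) < ∞ ∧
          |Real.log ((M.localLR θ₀ η₀ PiH x (h n x)).toReal /
                (M.localLR θ₀ η₀ PiH x 0).toReal) -
            ((√(n : ℝ))⁻¹ * ∑ i, inner ℝ (h n x) (l (x i)) -
              1 / 2 * ((h n x).ofLp ⬝ᵥ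
                (infoMatrix (M.P θ₀ η₀) l).mulVec (h n x).ofLp))| ≤ ε)})
        atTop (𝓝 0)

/-- The total variation distance `sup_A |ν₁(A) - ν₂(A)|` over measurable sets `A`. -/
def tvDistance {E : Type*} [MeasurableSpace E] (ν₁ ν₂ : Measure E) : ℝ :=
  ⨆ A : {A : Set E // MeasurableSet A}, |ν₁.real A - ν₂.real A|

end

/-! The posterior density of `h` is proportional to `s_n(h) f(θ₀ + h/√n)`. On a fixed ball the LAN
expansion makes `s_n(h)` close to `s_n(0)` times the exponential of a quadratic in `h`, and
thickness makes `f` nearly constant. After completing the square, that exponential is an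
unnormalized `N(Δ̃_n, Ĩ⁻¹)` density. So posterior and Gaussian are nearly proportional on the ball;
as both put nearly all their mass there, the unknown constant must be near one and the total
variation distance is small (`tvDistance_le_of_nearly_proportional`). No normalizing constant is
ever computed.

Two points need an argument. The expansion is assumed only along random sequences: applying it at a
measurably selected bad point, if there is one, makes it uniform over balls
(`HasILAN.tendsto_forall_closedBall`). Concentration is assumed only for radii tending to infinity:
a diagonal argument gives a fixed radius (`exists_radius_localPosterior`). For the Gaussian, a fixed
radius suffices because `Δ̃_n` is bounded in probability. -/

/-! ### Gaussian densities up to a constant, and Gaussian tails -/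

/-- Pushing forward a measure whose density factors through the map. -/
lemma map_withDensity_comp {α β : Type*} [MeasurableSpace α] [MeasurableSpace β] (μ : Measure α)
    {g : α → β} (hg : Measurable g) {F : β → ℝ≥0∞} (hF : Measurable F) :
    (μ.withDensity fun a => F (g a)).map g = (μ.map g).withDensity F := by
  ext s hs
  rw [Measure.map_apply hg hs, withDensity_apply _ (hg hs), withDensity_apply _ hs,
    setLIntegral_map hs hF hg]

/-- The standard Gaussian measure has a density proportional to `exp (-‖x‖² / 2)`. -/
lemma exists_stdGaussian_eq_smul_withDensity (ι : Type*) [Fintype ι] :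
    ∃ b : ℝ≥0∞, stdGaussian (EuclideanSpace ℝ ι) =
      b • volume.withDensity fun x : EuclideanSpace ℝ ι =>
        ENNReal.ofReal (Real.exp (-‖x‖ ^ 2 / 2)) := by
  set E := EuclideanSpace ℝ ι
  have hint : Integrable (fun x : E => Real.exp (-‖x‖ ^ 2 / 2)) volume := by
    have := (GaussianFourier.integrable_cexp_neg_mul_sq_norm_add (V := E)
      (b := (1 / 2 : ℂ)) (by norm_num) 0 0).norm
    refine this.congr (ae_of_all _ fun x => ?_)
    simp only [Complex.norm_exp]
    congr 1
    simp [← Complex.ofReal_pow]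
    ring
  set ν : Measure E := volume.withDensity fun x => ENNReal.ofReal (Real.exp (-‖x‖ ^ 2 / 2)) with hν
  have hfin : IsFiniteMeasure ν := isFiniteMeasure_withDensity_ofReal hint.2
  have hchar : ∀ t : E, charFun ν t =
      (Real.pi / (1 / 2 : ℂ)) ^ (Module.finrank ℝ E / 2 : ℂ) * Complex.exp (-‖t‖ ^ 2 / 2) := by
    intro t
    rw [charFun_apply, hν, integral_withDensity_eq_integral_toReal_smul (by fun_prop) (by simp)]
    have := GaussianFourier.integral_cexp_neg_mul_sq_norm_add (V := E)
      (b := (1 / 2 : ℂ)) (by norm_num) Complex.I t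
    rw [show -(‖t‖ : ℂ) ^ 2 / 2 = Complex.I ^ 2 * ‖t‖ ^ 2 / (4 * (1 / 2)) by
      rw [Complex.I_sq]; ring, ← this]
    refine integral_congr_ae (ae_of_all _ fun x => ?_)
    simp only [ENNReal.toReal_ofReal (Real.exp_pos _).le, Complex.real_smul, Complex.ofReal_exp,
      ← Complex.exp_add]
    congr 1
    push_cast
    rw [real_inner_comm]
    ring
  set c : ℂ := (Real.pi / (1 / 2 : ℂ)) ^ (Module.finrank ℝ E / 2 : ℂ)
  -- At `t = 0` the characteristic function is the total mass, so `c` is the normalization and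
  -- cancels.
  have hc : (ν.real Set.univ : ℂ) = c := by
    have := hchar 0
    rw [charFun_zero] at this
    simpa using this
  have hc0 : c ≠ 0 := by
    have : (Real.pi / (1 / 2 : ℂ)) ≠ 0 := by simp [Real.pi_ne_zero]
    exact fun h => this (Complex.cpow_eq_zero_iff _ _ |>.1 h).1
  have hu : ν Set.univ ≠ 0 := fun h => hc0 (by rw [← hc]; simp [Measure.real, h])
  refine ⟨(ν Set.univ)⁻¹, ?_⟩
  have : IsFiniteMeasure ((ν Set.univ)⁻¹ • ν) := Measure.smul_finite _ (by simp [hu])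
  refine Measure.ext_of_charFun ?_
  ext t
  rw [charFun_stdGaussian, charFun_apply, integral_smul_measure, ← charFun_apply, hchar t,
    ENNReal.toReal_inv, ← Measure.real, Complex.real_smul, Complex.ofReal_inv, hc,
    inv_mul_cancel_left₀ hc0]

open scoped MatrixOrder in
/-- A nondegenerate multivariate Gaussian measure with precision matrix `A` and mean `A⁻¹ v` has a
density proportional to `exp (⟪h, v⟫ - hᵀ A h / 2)`. -/
lemma exists_multivariateGaussian_eq_smul_withDensity {ι : Type*} [Fintype ι] [DecidableEq ι]
    {A : Matrix ι ι ℝ} (hA : A.PosDef) {m v : EuclideanSpace ℝ ι}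
    (hm : A.mulVec m.ofLp = v.ofLp) :
    ∃ b : ℝ≥0∞, b ≠ 0 ∧ b ≠ ∞ ∧ multivariateGaussian m A⁻¹ =
      b • volume.withDensity fun h : EuclideanSpace ℝ ι =>
        ENNReal.ofReal (Real.exp (inner ℝ h v - 1 / 2 * (h.ofLp ⬝ᵥ A.mulVec h.ofLp))) := by
  obtain ⟨b₀, hb₀⟩ := exists_stdGaussian_eq_smul_withDensity ι
  have hS : (A⁻¹).PosDef := hA.inv
  set R := CFC.sqrt A⁻¹ with hR
  have hRR : R * R = A⁻¹ := CFC.sqrt_mul_sqrt_self _ hS.posSemidef.nonneg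
  have hAu : IsUnit A.det := (Matrix.isUnit_iff_isUnit_det _).1 hA.isUnit
  -- The goal is `R A R = 1`: the substitution `h = m + R x` then turns the quadratic form of `A`
  -- into `‖x‖²`.
  have hARR : A * R * R = 1 := by rw [mul_assoc, hRR, Matrix.mul_nonsing_inv _ hAu]
  have hRAR : R * (A * R) = 1 := mul_eq_one_comm.1 hARR
  have hRt : R.transpose = R := by
    have := (CFC.sqrt_nonneg A⁻¹).isSelfAdjoint
    rw [← hR] at this
    rwa [IsSelfAdjoint, Matrix.star_eq_conjTranspose,
      Matrix.conjTranspose_eq_transpose_of_trivial] at this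
  have hAt : A.transpose = A := by
    rw [← Matrix.conjTranspose_eq_transpose_of_trivial, hA.isHermitian.eq]
  set L : EuclideanSpace ℝ ι →L[ℝ] EuclideanSpace ℝ ι := Matrix.toEuclideanCLM (𝕜 := ℝ) R with hL
  have hLap : ∀ x, (L x).ofLp = R.mulVec x.ofLp := fun x => rfl
  have hquad : ∀ x, (L x).ofLp ⬝ᵥ A.mulVec (L x).ofLp = ‖x‖ ^ 2 := by
    intro x
    rw [hLap, Matrix.mulVec_mulVec, ← Matrix.vecMul_transpose, hRt, ← Matrix.dotProduct_mulVec,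
      Matrix.mulVec_mulVec, hRAR, Matrix.one_mulVec, EuclideanSpace.real_norm_sq_eq]
    simp [dotProduct, sq]
  have hdet : LinearMap.det (L : EuclideanSpace ℝ ι →ₗ[ℝ] EuclideanSpace ℝ ι) ≠ 0 := by
    have h1 : L * Matrix.toEuclideanCLM (𝕜 := ℝ) (A * R) = 1 := by
      rw [hL, ← map_mul, hRAR, map_one]
    have h2 := congrArg (fun T : EuclideanSpace ℝ ι →L[ℝ] EuclideanSpace ℝ ι =>
      LinearMap.det (T : EuclideanSpace ℝ ι →ₗ[ℝ] EuclideanSpace ℝ ι)) h1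
    intro h0
    simp only [ContinuousLinearMap.toLinearMap_mul, map_mul, h0, zero_mul] at h2
    simp at h2
  set F : EuclideanSpace ℝ ι → ℝ≥0∞ := fun h =>
        ENNReal.ofReal (Real.exp (inner ℝ h v - 1 / 2 * (h.ofLp ⬝ᵥ A.mulVec h.ofLp))) with hF
  have hFm : Measurable F := by
    refine ENNReal.measurable_ofReal.comp (Real.measurable_exp.comp (Continuous.measurable ?_))
    simp only [dotProduct, Matrix.mulVec]
    fun_prop
  -- Completing the square: at `h = m + L x` the exponent is `⟪m, v⟫ / 2 - ‖x‖² / 2`.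
  set K := Real.exp (1 / 2 * inner ℝ m v)
  have hKF : ∀ x, ENNReal.ofReal (Real.exp (-‖x‖ ^ 2 / 2)) =
      (ENNReal.ofReal K)⁻¹ * F (m + L x) := by
    intro x
    rw [← ENNReal.ofReal_inv_of_pos (Real.exp_pos _), ← Real.exp_neg, hF,
      ← ENNReal.ofReal_mul (Real.exp_pos _).le, ← Real.exp_add]
    congr 2
    have e1 : inner ℝ (m + L x) v = m.ofLp ⬝ᵥ A.mulVec m.ofLp + (L x).ofLp ⬝ᵥ A.mulVec m.ofLp := by
      rw [inner_add_left, hm]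
      simp [PiLp.inner_apply, dotProduct, mul_comm]
    have e2 : inner ℝ m v = m.ofLp ⬝ᵥ A.mulVec m.ofLp := by
      rw [hm]
      simp [PiLp.inner_apply, dotProduct, mul_comm]
    have e3 : m.ofLp ⬝ᵥ A.mulVec (L x).ofLp = (L x).ofLp ⬝ᵥ A.mulVec m.ofLp := by
      rw [Matrix.dotProduct_mulVec, ← Matrix.mulVec_transpose, hAt, dotProduct_comm]
    rw [e1, e2, WithLp.ofLp_add, Matrix.mulVec_add, add_dotProduct, dotProduct_add, dotProduct_add,
      e3, hquad]
    ring
  have hgm : Measurable fun x => m + L x := by fun_prop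
  have hmap : (volume : Measure (EuclideanSpace ℝ ι)).map (fun x => m + L x) =
      ENNReal.ofReal |(LinearMap.det (L : EuclideanSpace ℝ ι →ₗ[ℝ] EuclideanSpace ℝ ι))⁻¹| •
        volume := by
    have := Measure.map_linearMap_addHaar_eq_smul_addHaar
      (volume : Measure (EuclideanSpace ℝ ι)) hdet
    have h3 : (fun x => m + L x) = (fun x => m + x) ∘ L := rfl
    rw [h3, ← Measure.map_map (by fun_prop) (by fun_prop)]
    rw [ContinuousLinearMap.coe_coe] at this
    rw [this, Measure.map_smul, map_add_left_eq_self]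
  have hmain : ∃ b : ℝ≥0∞, multivariateGaussian m A⁻¹ = b • volume.withDensity F := by
    refine ⟨b₀ * ((ENNReal.ofReal K)⁻¹ *
      ENNReal.ofReal |(LinearMap.det (L : EuclideanSpace ℝ ι →ₗ[ℝ] EuclideanSpace ℝ ι))⁻¹|), ?_⟩
    rw [multivariateGaussian, hb₀, ← hR, ← hL, Measure.map_smul]
    simp_rw [hKF]
    rw [show (fun x => (ENNReal.ofReal K)⁻¹ * F (m + L x)) =
      (ENNReal.ofReal K)⁻¹ • fun x => F (m + L x) from rfl,
      withDensity_smul (f := fun x => F (m + L x)) _ (hFm.comp hgm), Measure.map_smul, map_withDensity_comp _ hgm hFm, hmap,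
      withDensity_smul_measure, smul_smul, smul_smul, mul_assoc]
  obtain ⟨b, hb⟩ := hmain
  have huniv : b * volume.withDensity F Set.univ = 1 := by
    rw [← smul_eq_mul, ← Measure.smul_apply, ← hb, measure_univ]
  refine ⟨b, ?_, ?_, hb⟩
  · rintro rfl; simp at huniv
  · rintro rfl
    by_cases h : volume.withDensity F Set.univ = 0
    · simp [h] at huniv
    · rw [ENNReal.top_mul h] at huniv
      exact ENNReal.top_ne_one huniv

/-- Gaussian measures with a fixed covariance matrix concentrate uniformly around their mean. -/
lemma exists_forall_le_multivariateGaussian_closedBall {ι : Type*} [Fintype ι] [DecidableEq ι]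
    (S : Matrix ι ι ℝ) {t : ℝ} (ht : 0 < t) :
    ∃ r : ℝ, ∀ (m : EuclideanSpace ℝ ι) (R : ℝ), ‖m‖ + r ≤ R →
      ENNReal.ofReal (1 - t) ≤ multivariateGaussian m S (Metric.closedBall 0 R) := by
  have hlim : Tendsto (fun n : ℕ => multivariateGaussian 0 S (Metric.closedBall 0 (n : ℝ))) atTop
      (𝓝 1) := by
    have h := tendsto_measure_iUnion_atTop (μ := multivariateGaussian (0 : EuclideanSpace ℝ ι) S)
      (s := fun n : ℕ => Metric.closedBall 0 (n : ℝ))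
      (fun a b hab => Metric.closedBall_subset_closedBall (by exact_mod_cast hab))
    rwa [Metric.iUnion_closedBall_nat, measure_univ] at h
  have hlt : ENNReal.ofReal (1 - t) < 1 := by
    rw [ENNReal.ofReal_lt_one]; linarith
  obtain ⟨n, hn⟩ := (hlim.eventually (lt_mem_nhds hlt)).exists
  -- The radius `n` serves the centred Gaussian; translating by `m` adds at most `‖m‖` to the norm,
  -- so it works for all means.
  refine ⟨n, fun m R hR => hn.le.trans ?_⟩
  rw [multivariateGaussian, multivariateGaussian, Measure.map_apply (by fun_prop)
    Metric.isClosed_closedBall.measurableSet, Measure.map_apply (by fun_prop)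
    Metric.isClosed_closedBall.measurableSet]
  refine measure_mono fun x hx => ?_
  simp only [Set.mem_preimage, zero_add, mem_closedBall_zero_iff] at hx ⊢
  exact (norm_add_le _ _).trans (by linarith)

/-! ### Total variation from near proportionality -/

/-- Two measures that are nearly proportional on a set carrying nearly all their mass are close in
total variation. -/
lemma tvDistance_le_of_nearly_proportional {E : Type*} [MeasurableSpace E] {ν N : Measure E}
    [IsProbabilityMeasure N] (hν : ν Set.univ ≤ 1) {B : Set E} (hB : MeasurableSet B)
    {a t : ℝ} (ha : 1 ≤ a) (ht : t < 1)
    (hνB : ENNReal.ofReal (1 - t) ≤ ν B) (hNB : ENNReal.ofReal (1 - t) ≤ N B) {κ : ℝ≥0∞}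
    (h₁ : ∀ A ⊆ B, MeasurableSet A → ν A ≤ ENNReal.ofReal a * (κ * N A))
    (h₂ : ∀ A ⊆ B, MeasurableSet A → κ * N A ≤ ENNReal.ofReal a * ν A) :
    tvDistance ν N ≤ a ^ 2 / (1 - t) - 1 + t := by
  have hfin : IsFiniteMeasure ν := ⟨hν.trans_lt ENNReal.one_lt_top⟩
  have hνr : ∀ A, ν.real A ≤ 1 := fun A =>
    ENNReal.toReal_le_of_le_ofReal zero_le_one (by simpa using (measure_mono A.subset_univ).trans hν)
  have ha0 : 0 ≤ a := by linarith
  have ht1 : 0 < 1 - t := by linarith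
  have hνBr : 1 - t ≤ ν.real B := (ENNReal.ofReal_le_iff_le_toReal (measure_ne_top _ _)).1 hνB
  have hNBr : 1 - t ≤ N.real B := (ENNReal.ofReal_le_iff_le_toReal (measure_ne_top _ _)).1 hNB
  have hκ : κ ≠ ∞ := by
    rintro rfl
    have hN0 : N B ≠ 0 := fun h => by simp [Measure.real, h] at hNBr; linarith
    have := h₂ B subset_rfl hB
    rw [ENNReal.top_mul hN0] at this
    exact (ENNReal.mul_ne_top ENNReal.ofReal_ne_top (measure_ne_top ν B)) (top_le_iff.1 this)
  have h₁r : ∀ A ⊆ B, MeasurableSet A → ν.real A ≤ a * (κ.toReal * N.real A) := by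
    intro A hAB hA
    have := ENNReal.toReal_mono (ENNReal.mul_ne_top ENNReal.ofReal_ne_top
      (ENNReal.mul_ne_top hκ (measure_ne_top _ _))) (h₁ A hAB hA)
    simpa [Measure.real, ENNReal.toReal_mul, ENNReal.toReal_ofReal ha0] using this
  have h₂r : ∀ A ⊆ B, MeasurableSet A → κ.toReal * N.real A ≤ a * ν.real A := by
    intro A hAB hA
    have := ENNReal.toReal_mono (ENNReal.mul_ne_top ENNReal.ofReal_ne_top
      (measure_ne_top _ _)) (h₂ A hAB hA)
    simpa [Measure.real, ENNReal.toReal_mul, ENNReal.toReal_ofReal ha0] using this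
  set k := κ.toReal
  have hk0 : 0 ≤ k := ENNReal.toReal_nonneg
  -- Taking `A = B` pins the unknown constant: `(1 - t) / a ≤ k ≤ a / (1 - t)`.
  have hk_le : k * (1 - t) ≤ a := by
    calc k * (1 - t) ≤ k * N.real B := by gcongr
      _ ≤ a * ν.real B := h₂r B subset_rfl hB
      _ ≤ a * 1 := by gcongr; exact hνr B
      _ = a := mul_one a
  have hk_ge : 1 - t ≤ a * k := by
    calc 1 - t ≤ ν.real B := hνBr
      _ ≤ a * (k * N.real B) := h₁r B subset_rfl hB
      _ ≤ a * (k * 1) := by gcongr; exact measureReal_le_one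
      _ = a * k := by ring
  have key : ∀ x y : ℝ, 0 ≤ y → y ≤ 1 → (1 - t) * x ≤ a ^ 2 * y → x - y ≤ a ^ 2 / (1 - t) - 1 := by
    intro x y hy hy1 hxy
    have h3 : x ≤ a ^ 2 / (1 - t) * y := by
      rw [div_mul_eq_mul_div, le_div_iff₀ ht1]; linarith
    -- The negative case is void: `1 ≤ a`, and `1 - t ≤ N B ≤ 1`.
    by_cases hneg : a ^ 2 / (1 - t) - 1 < 0
    · exfalso
      have : (1 - t) ≤ 1 := hNBr.trans measureReal_le_one
      have : 1 ≤ a ^ 2 / (1 - t) := by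
        rw [le_div_iff₀ ht1]; nlinarith
      linarith
    · push Not at hneg
      nlinarith [mul_le_mul_of_nonneg_left hy1 hneg]
  have hsub : ∀ A ⊆ B, MeasurableSet A →
      |ν.real A - N.real A| ≤ a ^ 2 / (1 - t) - 1 := by
    intro A hAB hA
    refine abs_sub_le_iff.2 ⟨key _ _ measureReal_nonneg measureReal_le_one ?_,
      key _ _ measureReal_nonneg (hνr A) ?_⟩
    · calc (1 - t) * ν.real A ≤ (1 - t) * (a * (k * N.real A)) := by gcongr; exact h₁r A hAB hA
        _ = (k * (1 - t)) * (a * N.real A) := by ring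
        _ ≤ a * (a * N.real A) := by gcongr
        _ = a ^ 2 * N.real A := by ring
    · calc (1 - t) * N.real A ≤ (a * k) * N.real A := by gcongr
        _ = a * (k * N.real A) := by ring
        _ ≤ a * (a * ν.real A) := mul_le_mul_of_nonneg_left (h₂r A hAB hA) ha0
        _ = a ^ 2 * ν.real A := by ring
  -- Both masses outside `B` lie in `[0, t]`, so they differ by at most `t`, not `2t`.
  have hcompl : ∀ (ρ : Measure E) [IsFiniteMeasure ρ], ρ.real Set.univ ≤ 1 → 1 - t ≤ ρ.real B →
      ∀ A, MeasurableSet A → 0 ≤ ρ.real A - ρ.real (A ∩ B) ∧ ρ.real A - ρ.real (A ∩ B) ≤ t := by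
    intro ρ _ hρ hρB A hA
    have e1 := measureReal_inter_add_sdiff (μ := ρ) (s := A) hB
    have e2 : ρ.real (A \ B) ≤ ρ.real Bᶜ := measureReal_mono fun x hx => hx.2
    have e3 := measureReal_compl (μ := ρ) hB
    have e4 : 0 ≤ ρ.real (A \ B) := measureReal_nonneg
    constructor <;> linarith
  have : Nonempty {A : Set E // MeasurableSet A} := ⟨⟨∅, MeasurableSet.empty⟩⟩
  refine ciSup_le ?_
  rintro ⟨A, hA⟩
  have e1 := hcompl ν (hνr _) hνBr A hA
  have e2 := hcompl N measureReal_le_one hNBr A hA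
  have e3 := abs_le.1 (hsub (A ∩ B) Set.inter_subset_right (hA.inter hB))
  simp only
  rw [abs_le]
  constructor <;> linarith [e1.1, e1.2, e2.1, e2.2, e3.1, e3.2]

/-! ### Diagonal argument and local neighbourhoods -/

/-- A property that holds eventually along every sequence tending to infinity holds eventually at
some fixed index. -/
lemma exists_eventually_of_forall_tendsto_atTop {F : ℕ → ℕ → Prop}
    (h : ∀ m : ℕ → ℕ, Tendsto m atTop atTop → ∀ᶠ n in atTop, F n (m n)) :
    ∃ R, ∀ᶠ n in atTop, F n R := by
  by_contra! hcon
  -- If every `R` fails infinitely often, pick failures at increasing times `φ R`. The least `R`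
  -- with `n ≤ φ R` tends to infinity with `n` and equals `R` at time `φ R`, contradicting `h`.
  obtain ⟨φ, hφ, hF⟩ := extraction_forall_of_frequently (P := fun R n => ¬ F n R)
    hcon
  have hex : ∀ n, ∃ R, n ≤ φ R := fun n => ⟨n, hφ.id_le n⟩
  classical
  have hm : Tendsto (fun n => Nat.find (hex n)) atTop atTop := by
    refine tendsto_atTop.2 fun K => ?_
    filter_upwards [eventually_gt_atTop (φ K)] with n hn
    refine (Nat.le_find_iff _ _).2 fun j hj => ?_
    have := hφ hj
    omega
  have hfind : ∀ R, Nat.find (hex (φ R)) = R := fun R =>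
    (Nat.find_eq_iff _).2 ⟨le_rfl, fun j hj => not_le.2 (hφ hj)⟩
  obtain ⟨R, hR⟩ := (hφ.tendsto_atTop.eventually (h _ hm)).exists
  rw [hfind] at hR
  exact hF R hR

/-- Serves both for `Θ` and for the neighbourhood where the prior density is nearly constant. -/
lemma eventually_forall_closedBall_add_smul_mem {E : Type*} [NormedAddCommGroup E]
    [NormedSpace ℝ E] {θ₀ : E} {U : Set E} (hU : U ∈ 𝓝 θ₀) (R : ℝ) :
    ∀ᶠ n : ℕ in atTop, ∀ h ∈ Metric.closedBall (0 : E) R, θ₀ + (√(n : ℝ))⁻¹ • h ∈ U := by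
  obtain ⟨δ, hδ, hδU⟩ := Metric.mem_nhds_iff.1 hU
  have hlim : Tendsto (fun n : ℕ => (√(n : ℝ))⁻¹ * R) atTop (𝓝 0) := by
    have : Tendsto (fun n : ℕ => (√(n : ℝ))⁻¹) atTop (𝓝 0) :=
      tendsto_inv_atTop_zero.comp (Real.tendsto_sqrt_atTop.comp tendsto_natCast_atTop_atTop)
    simpa using this.mul_const R
  filter_upwards [hlim.eventually (gt_mem_nhds hδ)] with n hn h hh
  apply hδU
  rw [Metric.mem_ball, dist_eq_norm, add_sub_cancel_left, norm_smul, Real.norm_of_nonneg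
    (by positivity)]
  refine lt_of_le_of_lt ?_ hn
  gcongr
  simpa using hh

/-! ### I.i.d. samples, information matrix and centring -/

instance {X : Type*} [MeasurableSpace X] (Q : Measure X) [IsProbabilityMeasure Q] (n : ℕ) :
    IsProbabilityMeasure (sampleLaw Q n) := by
  unfold sampleLaw; infer_instance

lemma ae_sampleLaw_of_ae {X : Type*} [MeasurableSpace X] {Q : Measure X} [IsProbabilityMeasure Q]
    {p : X → Prop} (hp : ∀ᵐ x ∂Q, p x) (n : ℕ) : ∀ᵐ x ∂(sampleLaw Q n), ∀ i, p (x i) :=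
  eventually_all.2 fun _ => Measure.tendsto_eval_ae_ae.eventually hp

section Score

variable {k : ℕ} {X : Type*} [MeasurableSpace X] {Q : Measure X}
  {l : X → EuclideanSpace ℝ (Fin k)}

lemma memLp_apply (hl : MemLp l 2 Q) (i : Fin k) : MemLp (fun x => l x i) 2 Q :=
  (PiLp.proj (𝕜 := ℝ) 2 (fun _ : Fin k => ℝ) i).comp_memLp' hl

/-- This makes `Δ̃_n` the mean of the Gaussian whose density has the linear term of the LAN
expansion. -/
lemma mulVec_centring (hI : IsUnit (infoMatrix Q l).det) {n : ℕ} (x : Fin n → X) :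
    (infoMatrix Q l).mulVec (centring Q l x).ofLp = ((√(n : ℝ))⁻¹ • ∑ i, l (x i)).ofLp := by
  simp [centring, Matrix.mulVec_smul, Matrix.mulVec_sum, Matrix.mul_nonsing_inv _ hI]

/-- The quadratic form at `v` is the second moment of `vᵀ ℓ`. -/
lemma infoMatrix_posSemidef (hl : MemLp l 2 Q) : (infoMatrix Q l).PosSemidef := by
  refine Matrix.PosSemidef.of_dotProduct_mulVec_nonneg ?_ fun v => ?_
  · ext i j
    simp [infoMatrix, mul_comm]
  · have hint : ∀ i j, Integrable (fun x => l x i * l x j) Q := fun i j =>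
      (memLp_apply hl i).integrable_mul (memLp_apply hl j)
    have : star v ⬝ᵥ (infoMatrix Q l).mulVec v = ∫ x, (∑ i, v i * l x i) ^ 2 ∂Q := by
      have e : ∀ x, (∑ i, v i * l x i) ^ 2 = ∑ i, ∑ j, v i * v j * (l x i * l x j) := by
        intro x
        rw [sq, Finset.sum_mul_sum]
        refine Finset.sum_congr rfl fun i _ => Finset.sum_congr rfl fun j _ => by ring
      simp_rw [e]
      rw [integral_finsetSum _ fun i _ => integrable_finsetSum _ fun j _ => (hint i j).const_mul _]
      simp only [dotProduct, Matrix.mulVec, infoMatrix, Matrix.of_apply, Finset.mul_sum, star_trivial]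
      refine Finset.sum_congr rfl fun i _ => ?_
      rw [integral_finsetSum _ fun j _ => (hint i j).const_mul _]
      refine Finset.sum_congr rfl fun j _ => ?_
      rw [integral_const_mul]
      ring
    rw [this]
    exact integral_nonneg fun x => sq_nonneg _

lemma infoMatrix_posDef (hl : MemLp l 2 Q) (hI : IsUnit (infoMatrix Q l).det) :
    (infoMatrix Q l).PosDef :=
  (infoMatrix_posSemidef hl).posDef_iff_det_ne_zero.2 hI.ne_zero

variable [IsProbabilityMeasure Q]

/-- The centring sequence is bounded in probability. -/
lemma boundedInProb_centring (hl : MemLp l 2 Q) (hl0 : ∫ x, l x ∂Q = 0) :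
    BoundedInProb Q fun _ x => centring Q l x := by
  intro η hη
  set Y : Fin k → X → ℝ := fun i x => ((infoMatrix Q l)⁻¹.mulVec (l x).ofLp) i with hY
  have hYmem : ∀ i, MemLp (Y i) 2 Q := fun i => by
    simp only [hY, Matrix.mulVec, dotProduct]
    exact memLp_finsetSum _ fun j _ => (memLp_apply hl j).const_mul _
  have hYmean : ∀ i, ∫ x, Y i x ∂Q = 0 := fun i => by
    simp only [hY, Matrix.mulVec, dotProduct]
    rw [integral_finsetSum _ fun j _ =>
      ((memLp_apply hl j).integrable one_le_two).const_mul _]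
    refine Finset.sum_eq_zero fun j _ => ?_
    have hj : ∫ x, l x j ∂Q = 0 := by
      have := (PiLp.proj (𝕜 := ℝ) 2 (fun _ : Fin k => ℝ) j).integral_comp_comm
        (hl.integrable one_le_two)
      simpa [hl0] using this
    rw [integral_const_mul, hj, mul_zero]
  have hcheb : ∀ i (n : ℕ) (c : ℝ), 0 < c → sampleLaw Q n {x | c ≤ |centring Q l x i|} ≤
      ENNReal.ofReal (Var[Y i; Q] / c ^ 2) := by
    intro i n c hc
    set Z : (Fin n → X) → ℝ := ∑ j, fun x => Y i (x j) with hZ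
    have hZmem : ∀ j : Fin n, MemLp (fun x : Fin n → X => Y i (x j)) 2 (sampleLaw Q n) := fun j =>
      (hYmem i).comp_measurePreserving (measurePreserving_eval (fun _ : Fin n => Q) j)
    have hcen : (fun x : Fin n → X => centring Q l x i) = fun x => (√(n : ℝ))⁻¹ * Z x := by
      ext x
      simp [centring, hZ, hY]
    have hmem : MemLp (fun x : Fin n → X => centring Q l x i) 2 (sampleLaw Q n) := by
      rw [hcen]
      exact (memLp_finsetSum' _ fun j _ => hZmem j).const_mul _
    have hmean : ∫ x, centring Q l x i ∂(sampleLaw Q n) = 0 := by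
      rw [show (fun x : Fin n → X => centring Q l x i) = _ from hcen, integral_const_mul]
      simp only [hZ, Finset.sum_apply]
      rw [integral_finsetSum _ fun j _ => (hZmem j).integrable one_le_two]
      rw [Finset.sum_eq_zero, mul_zero]
      intro j _
      have := integral_comp_eval (μ := fun _ : Fin n => Q) (i := j)
        (hYmem i).aestronglyMeasurable
      rw [sampleLaw]
      exact this.trans (hYmean i)
    -- The scaling makes the bound free of `n`; equality may fail at `n = 0`, where the left side is
    -- `0`.
    have hvar : Var[fun x : Fin n → X => centring Q l x i; sampleLaw Q n] ≤ Var[Y i; Q] := by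
      have hs := variance_sum_pi (μ := fun _ : Fin n => Q) (X := fun _ => Y i) fun _ => hYmem i
      rw [hcen, variance_const_mul, sampleLaw, hZ, hs, Finset.sum_const, Finset.card_univ,
        Fintype.card_fin, nsmul_eq_mul, inv_pow, Real.sq_sqrt (Nat.cast_nonneg n), ← mul_assoc]
      rcases Nat.eq_zero_or_pos n with rfl | hn
      · simp [variance_nonneg]
      · rw [inv_mul_cancel₀ (by positivity), one_mul]
    have := meas_ge_le_variance_div_sq hmem hc
    rw [hmean] at this
    simp only [sub_zero] at this
    exact this.trans (ENNReal.ofReal_le_ofReal (by gcongr))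
  have hlim : Tendsto (fun c : ℝ => ∑ i, ENNReal.ofReal (Var[Y i; Q] / c ^ 2)) atTop (𝓝 0) := by
    rw [show (0 : ℝ≥0∞) = ∑ i : Fin k, ENNReal.ofReal 0 by simp]
    refine tendsto_finsetSum _ fun i _ => ENNReal.tendsto_ofReal ?_
    exact (tendsto_pow_atTop two_ne_zero).const_div_atTop _
  obtain ⟨c, hc, hc0⟩ := ((hlim.eventually (gt_mem_nhds hη)).and (eventually_gt_atTop 0)).exists
  -- A vector with all `k` coordinates below `c` in absolute value has norm at most this.
  refine ⟨√(k * c ^ 2), fun n => ?_⟩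
  calc sampleLaw Q n {x | √(k * c ^ 2) < ‖centring Q l x‖}
      ≤ sampleLaw Q n (⋃ i, {x | c ≤ |centring Q l x i|}) := by
        refine measure_mono fun x hx => ?_
        by_contra hcon
        simp only [Set.mem_iUnion, Set.mem_ofPred_eq, not_exists, not_le] at hcon hx
        refine not_le.2 hx ?_
        rw [EuclideanSpace.norm_eq]
        refine Real.sqrt_le_sqrt ?_
        calc ∑ i, ‖centring Q l x i‖ ^ 2 ≤ ∑ _i : Fin k, c ^ 2 := by
              refine Finset.sum_le_sum fun i _ => ?_
              gcongr
              exact (hcon i).le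
          _ = k * c ^ 2 := by simp
    _ ≤ ∑ i, sampleLaw Q n {x | c ≤ |centring Q l x i|} := measure_iUnion_fintype_le _ _
    _ ≤ ∑ i, ENNReal.ofReal (Var[Y i; Q] / c ^ 2) := Finset.sum_le_sum fun i _ => hcheb i n c hc0
    _ ≤ η := hc.le

end Score

/-! ### The local posterior density -/

namespace SemiparametricModel

variable {k : ℕ} {H X : Type*} [MeasurableSpace H] [MeasurableSpace X]
  (M : SemiparametricModel k H X) {θ₀ : EuclideanSpace ℝ (Fin k)} {η₀ : H}

lemma isProbabilityMeasure_P (hθ₀ : θ₀ ∈ M.Θ) : IsProbabilityMeasure (M.P θ₀ η₀) :=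
  ⟨by rw [P, withDensity_apply _ MeasurableSet.univ, setLIntegral_univ, M.lintegral_p _ hθ₀]⟩

lemma measurable_p_apply (θ : EuclideanSpace ℝ (Fin k)) (η : H) : Measurable (M.p θ η) :=
  M.measurable_p.comp (measurable_const.prodMk (measurable_const.prodMk measurable_id))

/-- Allows the division by `p_{θ₀,η₀}` in `s_n` to be undone in `[0, ∞]`. -/
lemma ae_P_density_pos_lt_top (hθ₀ : θ₀ ∈ M.Θ) :
    ∀ᵐ x ∂(M.P θ₀ η₀), M.p θ₀ η₀ x ≠ 0 ∧ M.p θ₀ η₀ x ≠ ∞ := by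
  have hm := M.measurable_p_apply θ₀ η₀
  rw [P, ae_withDensity_iff hm]
  filter_upwards [ae_lt_top hm (by rw [M.lintegral_p _ hθ₀]; simp)] with x hx h0
  exact ⟨h0, hx.ne⟩

lemma measurable_likelihood {n : ℕ} (x : Fin n → X) :
    Measurable fun z : EuclideanSpace ℝ (Fin k) × H => M.likelihood z.1 z.2 x := by
  unfold likelihood
  refine Finset.measurable_prod _ fun i _ => ?_
  exact M.measurable_p.comp (measurable_fst.prodMk (measurable_snd.prodMk measurable_const))

lemma measurable_integratedLR (θ₀ : EuclideanSpace ℝ (Fin k)) (η₀ : H) (PiH : Measure H)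
    [SFinite PiH] {n : ℕ} (x : Fin n → X) : Measurable (M.integratedLR θ₀ η₀ PiH x) := by
  unfold integratedLR
  refine Measurable.lintegral_prod_right' (f := fun z : EuclideanSpace ℝ (Fin k) × H =>
    ∏ i, M.p z.1 z.2 (x i) / M.p θ₀ η₀ (x i)) ?_
  refine Finset.measurable_prod _ fun i _ => Measurable.div_const ?_ _
  exact M.measurable_p.comp (measurable_fst.prodMk (measurable_snd.prodMk measurable_const))

lemma measurable_localLR_sample (θ₀ : EuclideanSpace ℝ (Fin k)) (η₀ : H) (PiH : Measure H)
    [SFinite PiH] (n : ℕ) (h : EuclideanSpace ℝ (Fin k)) :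
    Measurable fun x : Fin n → X => M.localLR θ₀ η₀ PiH x h := by
  unfold localLR integratedLR
  refine Measurable.lintegral_prod_right' (f := fun z : (Fin n → X) × H =>
    ∏ i, M.p (θ₀ + (√(n : ℝ))⁻¹ • h) z.2 (z.1 i) / M.p θ₀ η₀ (z.1 i)) ?_
  refine Finset.measurable_prod _ fun i _ => ?_
  have hi : Measurable fun z : (Fin n → X) × H => z.1 i := by fun_prop
  exact (M.measurable_p.comp (measurable_const.prodMk (measurable_snd.prodMk hi))).div
    ((M.measurable_p_apply θ₀ η₀).comp hi)

lemma localPosterior_univ_le_one (PiΘ : Measure (EuclideanSpace ℝ (Fin k))) (PiH : Measure H)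
    {n : ℕ} (x : Fin n → X) : M.localPosterior θ₀ PiΘ PiH x Set.univ ≤ 1 := by
  rw [localPosterior, Measure.map_apply (by fun_prop) MeasurableSet.univ, Set.preimage_univ,
    posterior, Measure.smul_apply, withDensity_apply _ MeasurableSet.univ, setLIntegral_univ,
    smul_eq_mul]
  exact ENNReal.inv_mul_le_one _

/-- The marginal posterior of the local parameter has a Lebesgue density proportional to the
localized integrated likelihood ratio times the localized prior density. -/
lemma exists_localPosterior_eq_smul_withDensity {f : EuclideanSpace ℝ (Fin k) → ℝ≥0∞}
    (hf : Measurable f) [SFinite (volume.withDensity f)] (PiH : Measure H) [SFinite PiH]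
    {n : ℕ} (hn : n ≠ 0) (x : Fin n → X)
    (hx : ∀ i, M.p θ₀ η₀ (x i) ≠ 0 ∧ M.p θ₀ η₀ (x i) ≠ ∞) :
    ∃ c : ℝ≥0∞, M.localPosterior θ₀ (volume.withDensity f) PiH x =
      c • volume.withDensity fun h =>
        M.localLR θ₀ η₀ PiH x h * f (θ₀ + (√(n : ℝ))⁻¹ • h) := by
  have hs : √(n : ℝ) ≠ 0 := by positivity
  set T : EuclideanSpace ℝ (Fin k) → EuclideanSpace ℝ (Fin k) := fun θ => √(n : ℝ) • (θ - θ₀)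
  have hT : Measurable T := by fun_prop
  set F : EuclideanSpace ℝ (Fin k) → ℝ≥0∞ := fun h =>
        M.localLR θ₀ η₀ PiH x h * f (θ₀ + (√(n : ℝ))⁻¹ • h)
  have hF : Measurable F := by
    have hg : Measurable fun h : EuclideanSpace ℝ (Fin k) => θ₀ + (√(n : ℝ))⁻¹ • h := by fun_prop
    exact ((M.measurable_integratedLR θ₀ η₀ PiH x).comp hg).mul (hf.comp hg)
  have hFT : ∀ θ, F (T θ) = M.integratedLR θ₀ η₀ PiH x θ * f θ := fun θ => by
    simp only [F, T, localLR, smul_smul, inv_mul_cancel₀ hs, one_smul, add_sub_cancel]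
  have hmapT : (volume : Measure (EuclideanSpace ℝ (Fin k))).map T =
      ENNReal.ofReal |(√(n : ℝ) ^ Module.finrank ℝ (EuclideanSpace ℝ (Fin k)))⁻¹| • volume := by
    rw [← Measure.map_addHaar_smul volume hs]
    rw [show T = (fun y => √(n : ℝ) • y) ∘ fun θ => θ - θ₀ from rfl,
      ← Measure.map_map (by fun_prop) (by fun_prop), map_sub_right_eq_self]
  -- `C` and the Jacobian of `T` do not depend on `h` and go into the constant `c`.
  set C : ℝ≥0∞ := ∏ i, M.p θ₀ η₀ (x i)
  have hlik : ∀ θ, ∫⁻ η, M.likelihood θ η x ∂PiH = C * M.integratedLR θ₀ η₀ PiH x θ := by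
    intro θ
    have hCtop : C ≠ ∞ := ENNReal.prod_ne_top fun i _ => (hx i).2
    rw [integratedLR, ← lintegral_const_mul' _ _ hCtop]
    refine lintegral_congr fun η => ?_
    rw [likelihood, ← Finset.prod_mul_distrib]
    exact Finset.prod_congr rfl fun i _ => (ENNReal.mul_div_cancel (hx i).1 (hx i).2).symm
  have hmap : ((((volume.withDensity f).prod PiH).withDensity
      fun z => M.likelihood z.1 z.2 x).map fun z => T z.1) =
      C • (volume.withDensity fun θ => F (T θ)).map T := by
    ext A hA
    have hTA : MeasurableSet (T ⁻¹' A) := hT hA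
    have hpre : MeasurableSet ((fun z : EuclideanSpace ℝ (Fin k) × H => T z.1) ⁻¹' A) :=
      (hT.comp measurable_fst) hA
    have hlm := M.measurable_likelihood x
    have him : Measurable fun θ => ∫⁻ η, M.likelihood θ η x ∂PiH := hlm.lintegral_prod_right'
    rw [Measure.map_apply (f := fun z : EuclideanSpace ℝ (Fin k) × H => T z.1)
      (hT.comp measurable_fst) hA, withDensity_apply _ hpre,
      Measure.smul_apply, Measure.map_apply hT hA, withDensity_apply _ hTA,
      show (fun z : EuclideanSpace ℝ (Fin k) × H => T z.1) ⁻¹' A = (T ⁻¹' A) ×ˢ Set.univ by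
        ext z; simp,
      setLIntegral_prod _ hlm.aemeasurable]
    simp only [Measure.restrict_univ]
    rw [setLIntegral_withDensity_eq_setLIntegral_mul _ hf him hTA, smul_eq_mul,
      ← lintegral_const_mul (f := fun θ => F (T θ)) _ (hF.comp hT)]
    refine lintegral_congr fun θ => ?_
    rw [Pi.mul_apply, hlik, hFT]
    ring
  refine ⟨(∫⁻ z, M.likelihood z.1 z.2 x ∂((volume.withDensity f).prod PiH))⁻¹ *
    (C * ENNReal.ofReal |(√(n : ℝ) ^ Module.finrank ℝ (EuclideanSpace ℝ (Fin k)))⁻¹|), ?_⟩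
  rw [localPosterior, posterior, Measure.map_smul, hmap, map_withDensity_comp _ hT hF, hmapT,
    withDensity_smul_measure, smul_smul, smul_smul, mul_assoc]

end SemiparametricModel

/-! ### Uniform LAN expansion and posterior tightness -/

/-- Without logarithms the expansion is a closed condition on `h`, so it passes from a dense set to
the whole ball. -/
lemma ofReal_mul_le_of_abs_log_div_sub_le {a b : ℝ≥0∞} {q ε : ℝ} (ha : 0 < a) (ha' : a < ∞)
    (hb : 0 < b) (hb' : b < ∞) (h : |Real.log (a.toReal / b.toReal) - q| ≤ ε) :
    ENNReal.ofReal (Real.exp (q - ε)) * b ≤ a ∧ a ≤ ENNReal.ofReal (Real.exp (q + ε)) * b := by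
  have ha0 := ENNReal.toReal_pos ha.ne' ha'.ne
  have hb0 := ENNReal.toReal_pos hb.ne' hb'.ne
  have hab : 0 < a.toReal / b.toReal := div_pos ha0 hb0
  obtain ⟨h1, h2⟩ := abs_le.1 h
  have hlo : Real.exp (q - ε) * b.toReal ≤ a.toReal := by
    rw [← le_div_iff₀ hb0, ← Real.le_log_iff_exp_le hab]; linarith
  have hhi : a.toReal ≤ Real.exp (q + ε) * b.toReal := by
    rw [← div_le_iff₀ hb0, ← Real.log_le_iff_le_exp hab]; linarith
  constructor
  · calc ENNReal.ofReal (Real.exp (q - ε)) * b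
        = ENNReal.ofReal (Real.exp (q - ε) * b.toReal) := by
          rw [ENNReal.ofReal_mul (Real.exp_pos _).le, ENNReal.ofReal_toReal hb'.ne]
      _ ≤ ENNReal.ofReal a.toReal := ENNReal.ofReal_le_ofReal hlo
      _ = a := ENNReal.ofReal_toReal ha'.ne
  · calc a = ENNReal.ofReal a.toReal := (ENNReal.ofReal_toReal ha'.ne).symm
      _ ≤ ENNReal.ofReal (Real.exp (q + ε) * b.toReal) := ENNReal.ofReal_le_ofReal hhi
      _ = ENNReal.ofReal (Real.exp (q + ε)) * b := by
          rw [ENNReal.ofReal_mul (Real.exp_pos _).le, ENNReal.ofReal_toReal hb'.ne]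

/-- The limiting local log-likelihood ratio `n^{-1/2} ∑ᵢ hᵀ ℓ(Xᵢ) - hᵀ Ĩ h / 2`. -/
noncomputable def localQuadratic {k : ℕ} {X : Type*} [MeasurableSpace X] (Q : Measure X)
    (l : X → EuclideanSpace ℝ (Fin k)) {n : ℕ} (x : Fin n → X) (h : EuclideanSpace ℝ (Fin k)) : ℝ :=
  inner ℝ h ((√(n : ℝ))⁻¹ • ∑ i, l (x i)) - 1 / 2 * (h.ofLp ⬝ᵥ (infoMatrix Q l).mulVec h.ofLp)

lemma continuous_localQuadratic {k : ℕ} {X : Type*} [MeasurableSpace X] (Q : Measure X)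
    (l : X → EuclideanSpace ℝ (Fin k)) {n : ℕ} (x : Fin n → X) :
    Continuous (localQuadratic Q l x) := by
  unfold localQuadratic
  simp only [dotProduct, Matrix.mulVec]
  fun_prop

namespace SemiparametricModel

variable {k : ℕ} {H X : Type*} [MeasurableSpace H] [MeasurableSpace X]
  {M : SemiparametricModel k H X} {θ₀ : EuclideanSpace ℝ (Fin k)} {η₀ : H}

/-- The integral LAN expansion holds uniformly over balls. -/
lemma HasILAN.tendsto_forall_closedBall (hθ₀ : θ₀ ∈ M.Θ) {PiH : Measure H} [SFinite PiH]
    (hcont : ∀ᶠ n : ℕ in atTop, ∀ᵐ x ∂(sampleLaw (M.P θ₀ η₀) n),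
      ContinuousOn (fun h => M.localLR θ₀ η₀ PiH x h) {h | θ₀ + (√(n : ℝ))⁻¹ • h ∈ M.Θ})
    {l : X → EuclideanSpace ℝ (Fin k)} (hl : AEStronglyMeasurable l (M.P θ₀ η₀))
    (hILAN : M.HasILAN θ₀ η₀ PiH l) {R ε : ℝ} (hR : 0 ≤ R) (hε : 0 < ε) :
    Tendsto (fun n => sampleLaw (M.P θ₀ η₀) n {x | ¬
      (0 < M.localLR θ₀ η₀ PiH x 0 ∧ M.localLR θ₀ η₀ PiH x 0 < ∞ ∧
        ∀ h ∈ Metric.closedBall (0 : EuclideanSpace ℝ (Fin k)) R,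
          ENNReal.ofReal (Real.exp (localQuadratic (M.P θ₀ η₀) l x h - ε)) *
              M.localLR θ₀ η₀ PiH x 0 ≤ M.localLR θ₀ η₀ PiH x h ∧
            M.localLR θ₀ η₀ PiH x h ≤
              ENNReal.ofReal (Real.exp (localQuadratic (M.P θ₀ η₀) l x h + ε)) *
                M.localLR θ₀ η₀ PiH x 0)}) atTop (𝓝 0) := by
  have := M.isProbabilityMeasure_P (η₀ := η₀) hθ₀
  let Q := M.P θ₀ η₀
  let s : (n : ℕ) → (Fin n → X) → EuclideanSpace ℝ (Fin k) → ℝ≥0∞ := fun n x h =>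
    M.localLR θ₀ η₀ PiH x h
  let good : (X → EuclideanSpace ℝ (Fin k)) → (n : ℕ) → (Fin n → X) →
      EuclideanSpace ℝ (Fin k) → Prop := fun l₁ n x h =>
    0 < s n x 0 ∧ s n x 0 < ∞ ∧ 0 < s n x h ∧ s n x h < ∞ ∧
      |Real.log ((s n x h).toReal / (s n x 0).toReal) -
        ((√(n : ℝ))⁻¹ * ∑ i, inner ℝ h (l₁ (x i)) -
          1 / 2 * (h.ofLp ⬝ᵥ (infoMatrix Q l).mulVec h.ofLp))| ≤ ε
  -- A measurable version of the score makes the good events, hence the selected point, measurable,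
  -- as `HasILAN` requires.
  let l' := hl.mk l
  have hl'm : Measurable l' := hl.stronglyMeasurable_mk.measurable
  have hgood_meas : ∀ n h, MeasurableSet {x | good l' n x h} := by
    intro n h
    have hs : ∀ h, Measurable fun x => s n x h := M.measurable_localLR_sample θ₀ η₀ PiH n
    have hsum : Measurable fun x : Fin n → X => ∑ i, inner ℝ h (l' (x i)) :=
      Finset.measurable_sum _ fun i _ =>
        measurable_const.inner (hl'm.comp (measurable_pi_apply i))
    have hlog : Measurable fun x : Fin n → X =>
        Real.log ((s n x h).toReal / (s n x 0).toReal) -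
          ((√(n : ℝ))⁻¹ * ∑ i, inner ℝ h (l' (x i)) -
            1 / 2 * (h.ofLp ⬝ᵥ (infoMatrix Q l).mulVec h.ofLp)) :=
      (Real.measurable_log.comp ((hs h).ennreal_toReal.div (hs 0).ennreal_toReal)).sub
        ((hsum.const_mul _).sub measurable_const)
    simp only [good, Set.ofPred_and]
    exact (measurableSet_lt measurable_const (hs 0)).inter
      ((measurableSet_lt (hs 0) measurable_const).inter
      ((measurableSet_lt measurable_const (hs h)).inter
      ((measurableSet_lt (hs h) measurable_const).inter
      (measurableSet_le hlog.abs measurable_const))))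
  have : Nonempty (Metric.closedBall (0 : EuclideanSpace ℝ (Fin k)) R) :=
    ⟨⟨0, Metric.mem_closedBall_self hR⟩⟩
  let d : ℕ → Metric.closedBall (0 : EuclideanSpace ℝ (Fin k)) R :=
    TopologicalSpace.denseSeq _
  have hd : DenseRange d := TopologicalSpace.denseRange_denseSeq _
  -- The first point of the dense sequence at which the expansion fails, if there is one.
  have hex : ∀ (n : ℕ) (x : Fin n → X), ∃ j, ¬ good l' n x (d j) ∨ ∀ i, good l' n x (d i) := by
    intro n x
    by_cases h : ∃ j, ¬ good l' n x (d j)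
    · obtain ⟨j, hj⟩ := h
      exact ⟨j, Or.inl hj⟩
    · push Not at h
      exact ⟨0, Or.inr h⟩
  classical
  let sel : (n : ℕ) → (Fin n → X) → EuclideanSpace ℝ (Fin k) := fun n x => d (Nat.find (hex n x))
  have hsel_meas : ∀ n, Measurable (sel n) := by
    intro n
    refine Measurable.find (f := fun j (_ : Fin n → X) => (d j : EuclideanSpace ℝ (Fin k)))
      (fun j => measurable_const) (fun j => ?_) (hex n)
    simp only [Set.ofPred_or, Set.ofPred_forall]
    exact (hgood_meas n (d j)).compl.union (MeasurableSet.iInter fun i => hgood_meas n (d i))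
  -- A good selected point means that no point of the dense sequence is bad.
  have hsel : ∀ n x, good l' n x (sel n x) → ∀ i, good l' n x (d i) := fun n x h =>
    (Nat.find_spec (hex n x)).resolve_left (not_not.2 h)
  have hsel_bdd : BoundedInProb Q sel := fun η _ => ⟨R, fun n => by
    have : {x | R < ‖sel n x‖} = ∅ := by
      refine Set.eq_empty_of_forall_notMem fun x hx => ?_
      have h1 := (d (Nat.find (hex n x))).2
      rw [mem_closedBall_zero_iff] at h1
      exact not_lt.2 h1 hx
    rw [this, measure_empty]
    exact zero_le⟩
  refine tendsto_of_tendsto_of_tendsto_of_le_of_le' tendsto_const_nhds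
    (hILAN sel hsel_meas hsel_bdd ε hε) (Eventually.of_forall fun n => zero_le) ?_
  filter_upwards [hcont, eventually_forall_closedBall_add_smul_mem (M.isOpen_Θ.mem_nhds hθ₀) R]
    with n hn hball
  refine measure_mono_ae ?_
  filter_upwards [hn, ae_sampleLaw_of_ae hl.ae_eq_mk n] with x hx hlx hbad hgood
  refine hbad ?_
  have hgood' : good l' n x (sel n x) := by
    have e : ∀ i, l' (x i) = l (x i) := fun i => (hlx i).symm
    simp only [good, e]
    exact hgood
  have hall := hsel n x hgood'
  have hs0 : s n x 0 < ∞ := (hall 0).2.1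
  refine ⟨(hall 0).1, hs0, fun h hh => ?_⟩
  have hsc : Continuous fun y : Metric.closedBall (0 : EuclideanSpace ℝ (Fin k)) R => s n x y :=
    continuousOn_iff_continuous_domRestrict.1 (hx.mono hball)
  have hbc : ∀ c : ℝ, Continuous fun y : Metric.closedBall (0 : EuclideanSpace ℝ (Fin k)) R =>
      ENNReal.ofReal (Real.exp (localQuadratic Q l x y + c)) * s n x 0 := fun c =>
    (ENNReal.continuous_mul_const hs0.ne).comp (ENNReal.continuous_ofReal.comp
      (Real.continuous_exp.comp
        (((continuous_localQuadratic Q l x).comp continuous_subtype_val).add continuous_const)))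
  -- Continuity of `s_n` extends the bounds from the dense sequence to the ball.
  refine hd.induction_on (p := fun y : Metric.closedBall (0 : EuclideanSpace ℝ (Fin k)) R =>
      ENNReal.ofReal (Real.exp (localQuadratic Q l x y - ε)) * s n x 0 ≤ s n x y ∧
        s n x y ≤ ENNReal.ofReal (Real.exp (localQuadratic Q l x y + ε)) * s n x 0)
    ⟨h, hh⟩ ?_ fun j => ?_
  · exact (isClosed_le (by simpa only [sub_eq_add_neg] using hbc (-ε)) hsc).inter
      (isClosed_le hsc (hbc ε))
  · obtain ⟨h1, h2, h3, h4, h5⟩ := hall j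
    refine ofReal_mul_le_of_abs_log_div_sub_le h3 h4 h1 h2 ?_
    have e : localQuadratic Q l x (d j) = (√(n : ℝ))⁻¹ * ∑ i, inner ℝ (d j).1 (l' (x i)) -
          1 / 2 * ((d j : EuclideanSpace ℝ (Fin k)).ofLp ⬝ᵥ
            (infoMatrix Q l).mulVec (d j : EuclideanSpace ℝ (Fin k)).ofLp) := by
      rw [localQuadratic, inner_smul_right, inner_sum]
      simp only [show ∀ i, l' (x i) = l (x i) from fun i => (hlx i).symm]
    rw [e]
    exact h5

/-- Posterior concentration at every slowly growing radius yields tightness. -/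
lemma exists_radius_localPosterior {PiΘ : Measure (EuclideanSpace ℝ (Fin k))}
    {PiH : Measure H}
    (hrate : ∀ m : ℕ → ℝ, Tendsto m atTop atTop →
      ConvergesInProb (M.P θ₀ η₀)
        (fun n x => (M.localPosterior θ₀ PiΘ PiH x).real {h | ‖h‖ ≤ m n}) 1)
    {t : ℝ} (ht : 0 < t) {η : ℝ≥0∞} (hη : 0 < η) :
    ∃ R₀ : ℝ, ∀ R ≥ R₀, ∀ᶠ n in atTop, sampleLaw (M.P θ₀ η₀) n
      {x | ¬ ENNReal.ofReal (1 - t) ≤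
        M.localPosterior θ₀ PiΘ PiH x (Metric.closedBall 0 R)} ≤ η := by
  obtain ⟨R₀, hR₀⟩ := exists_eventually_of_forall_tendsto_atTop
    (F := fun n R => sampleLaw (M.P θ₀ η₀) n {x | ¬ ENNReal.ofReal (1 - t) ≤
        M.localPosterior θ₀ PiΘ PiH x (Metric.closedBall 0 (R : ℝ))} ≤ η) fun m hm => by
    -- Mass below `1 - t` is a deviation from `1` by more than `t`.
    have h := hrate (fun n => m n) (tendsto_natCast_atTop_atTop.comp hm) t ht
    filter_upwards [h.eventually (gt_mem_nhds hη)] with n hn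
    refine (measure_mono fun x hx => ?_).trans hn.le
    have hset : {h : EuclideanSpace ℝ (Fin k) | ‖h‖ ≤ m n} = Metric.closedBall 0 (m n : ℝ) := by
      ext h; simp
    have hfin : M.localPosterior θ₀ PiΘ PiH x (Metric.closedBall 0 (m n : ℝ)) ≠ ∞ :=
      ((measure_mono (Set.subset_univ _)).trans
        (M.localPosterior_univ_le_one PiΘ PiH x)).trans_lt ENNReal.one_lt_top |>.ne
    have hlt := not_le.1 hx
    rw [← ENNReal.ofReal_toReal hfin, ENNReal.ofReal_lt_ofReal_iff_of_nonneg
      ENNReal.toReal_nonneg] at hlt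
    simp only [Set.mem_ofPred_eq, hset, Measure.real]
    rw [abs_sub_comm]
    exact lt_of_lt_of_le (by linarith) (le_abs_self _)
  refine ⟨R₀, fun R hR => ?_⟩
  filter_upwards [hR₀] with n hn
  refine (measure_mono ?_).trans hn
  intro x (hx : ¬ _) h
  exact hx (h.trans (measure_mono (Metric.closedBall_subset_closedBall hR)))

end SemiparametricModel

/-! ### Assembly of the theorem -/

/-- Total variation bound for measures with nearly proportional densities on a set carrying nearly
all their mass. -/
lemma tvDistance_le_of_nearly_proportional_density {E : Type*} [MeasurableSpace E]
    {μ ν N : Measure E} [IsProbabilityMeasure N] (hν : ν Set.univ ≤ 1) {w g : E → ℝ≥0∞}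
    {b c K : ℝ≥0∞} (hνw : ν = c • μ.withDensity w) (hNg : N = b • μ.withDensity g)
    (hb : b ≠ 0) (hb' : b ≠ ∞) (hK : K ≠ ∞) {B : Set E} (hB : MeasurableSet B)
    {a t : ℝ} (ha : 1 ≤ a) (ht : t < 1)
    (hνB : ENNReal.ofReal (1 - t) ≤ ν B) (hNB : ENNReal.ofReal (1 - t) ≤ N B)
    (h₁ : ∀ h ∈ B, w h ≤ ENNReal.ofReal a * (K * g h))
    (h₂ : ∀ h ∈ B, K * g h ≤ ENNReal.ofReal a * w h) :
    tvDistance ν N ≤ a ^ 2 / (1 - t) - 1 + t := by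
  have hνA : ∀ A, MeasurableSet A → ν A = c * ∫⁻ h in A, w h ∂μ := fun A hA => by
    rw [hνw, Measure.smul_apply, withDensity_apply _ hA, smul_eq_mul]
  have hNA : ∀ A, MeasurableSet A → c * K * b⁻¹ * N A = c * ∫⁻ h in A, K * g h ∂μ := fun A hA => by
    rw [hNg, Measure.smul_apply, withDensity_apply _ hA, smul_eq_mul, lintegral_const_mul' _ _ hK]
    calc c * K * b⁻¹ * (b * ∫⁻ h in A, g h ∂μ) = (b⁻¹ * b) * (c * (K * ∫⁻ h in A, g h ∂μ)) := by ring
      _ = _ := by rw [ENNReal.inv_mul_cancel hb hb', one_mul]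
  -- The factor `b⁻¹` cancels the Gaussian normalization; the value of `c` is immaterial.
  refine tvDistance_le_of_nearly_proportional (κ := c * K * b⁻¹) hν hB ha ht hνB hNB
    (fun A hAB hA => ?_) (fun A hAB hA => ?_)
  · rw [hνA A hA, hNA A hA, mul_left_comm, ← lintegral_const_mul' _ _ ENNReal.ofReal_ne_top]
    gcongr 1
    exact setLIntegral_mono' hA fun h hh => h₁ h (hAB hh)
  · rw [hνA A hA, hNA A hA, mul_left_comm, ← lintegral_const_mul' _ _ ENNReal.ofReal_ne_top]
    gcongr 1
    exact setLIntegral_mono' hA fun h hh => h₂ h (hAB hh)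

/-- Positive continuous functions are nearly constant, multiplicatively, near a point. -/
lemma eventually_exp_mul_le_of_continuousAt {E : Type*} [TopologicalSpace E] {f : E → ℝ} {θ₀ : E}
    (hf : ContinuousAt f θ₀) (hf0 : 0 < f θ₀) {ε : ℝ} (hε : 0 < ε) :
    ∀ᶠ θ in 𝓝 θ₀, f θ ≤ Real.exp ε * f θ₀ ∧ f θ₀ ≤ Real.exp ε * f θ := by
  have h1 : 1 < Real.exp ε := Real.one_lt_exp_iff.2 hε
  have hlo : ContinuousAt (fun θ => Real.exp ε * f θ) θ₀ := hf.const_mul _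
  filter_upwards [hf.eventually (gt_mem_nhds (show f θ₀ < Real.exp ε * f θ₀ by nlinarith)),
    hlo.eventually (lt_mem_nhds (show f θ₀ < Real.exp ε * f θ₀ by nlinarith))] with θ ha hb
  exact ⟨ha.le, hb.le⟩

/-- One `ε` comes from the likelihood ratio `s`, the other from the prior density `u`. -/
lemma mul_ofReal_nearly_proportional {s s₀ : ℝ≥0∞} {u u₀ q ε : ℝ}
    (hs : ENNReal.ofReal (Real.exp (q - ε)) * s₀ ≤ s ∧ s ≤ ENNReal.ofReal (Real.exp (q + ε)) * s₀)
    (hu : u ≤ Real.exp ε * u₀ ∧ u₀ ≤ Real.exp ε * u) :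
    s * ENNReal.ofReal u ≤ ENNReal.ofReal (Real.exp (2 * ε)) *
        (s₀ * ENNReal.ofReal u₀ * ENNReal.ofReal (Real.exp q)) ∧
      s₀ * ENNReal.ofReal u₀ * ENNReal.ofReal (Real.exp q) ≤
        ENNReal.ofReal (Real.exp (2 * ε)) * (s * ENNReal.ofReal u) := by
  have e : ∀ y z : ℝ, ENNReal.ofReal (Real.exp (y + z)) =
      ENNReal.ofReal (Real.exp y) * ENNReal.ofReal (Real.exp z) := fun y z => by
    rw [Real.exp_add, ENNReal.ofReal_mul (Real.exp_pos _).le]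
  have hu₁ : ENNReal.ofReal u ≤ ENNReal.ofReal (Real.exp ε) * ENNReal.ofReal u₀ := by
    rw [← ENNReal.ofReal_mul (Real.exp_pos _).le]
    exact ENNReal.ofReal_le_ofReal hu.1
  have hu₂ : ENNReal.ofReal u₀ ≤ ENNReal.ofReal (Real.exp ε) * ENNReal.ofReal u := by
    rw [← ENNReal.ofReal_mul (Real.exp_pos _).le]
    exact ENNReal.ofReal_le_ofReal hu.2
  have hs₂ : ENNReal.ofReal (Real.exp q) * s₀ ≤ ENNReal.ofReal (Real.exp ε) * s := by
    calc ENNReal.ofReal (Real.exp q) * s₀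
        = ENNReal.ofReal (Real.exp ε) * (ENNReal.ofReal (Real.exp (q - ε)) * s₀) := by
          rw [← mul_assoc, ← e, add_sub_cancel]
      _ ≤ ENNReal.ofReal (Real.exp ε) * s := by gcongr; exact hs.1
  rw [two_mul, e]
  constructor
  · calc s * ENNReal.ofReal u ≤ (ENNReal.ofReal (Real.exp (q + ε)) * s₀) *
          (ENNReal.ofReal (Real.exp ε) * ENNReal.ofReal u₀) := mul_le_mul' hs.2 hu₁
      _ = _ := by rw [e]; ring
  · calc s₀ * ENNReal.ofReal u₀ * ENNReal.ofReal (Real.exp q)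
        = (ENNReal.ofReal (Real.exp q) * s₀) * ENNReal.ofReal u₀ := by ring
      _ ≤ (ENNReal.ofReal (Real.exp ε) * s) * (ENNReal.ofReal (Real.exp ε) * ENNReal.ofReal u) :=
          mul_le_mul' hs₂ hu₂
      _ = _ := by ring

/-- The total variation bound with `a = exp (2t)` is continuous in `t` and vanishes at `0`. -/
lemma exists_pos_exp_div_one_sub_lt {ε : ℝ} (hε : 0 < ε) :
    ∃ t : ℝ, 0 < t ∧ t < 1 ∧ Real.exp (2 * t) ^ 2 / (1 - t) - 1 + t < ε := by
  have hc : ContinuousAt (fun t : ℝ => Real.exp (2 * t) ^ 2 / (1 - t) - 1 + t) 0 := by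
    refine ContinuousAt.add (ContinuousAt.sub (ContinuousAt.div ?_ ?_ (by norm_num)) ?_) ?_ <;>
      fun_prop
  have h0 : Real.exp (2 * (0 : ℝ)) ^ 2 / (1 - 0) - 1 + 0 < ε := by simpa using hε
  have h1 := (hc.eventually (gt_mem_nhds h0)).and (gt_mem_nhds (show (0 : ℝ) < 1 by norm_num))
  obtain ⟨t, ⟨ht, ht1⟩, ht0⟩ :=
    ((h1.filter_mono nhdsWithin_le_nhds).and (self_mem_nhdsWithin (s := Set.Ioi (0 : ℝ)))).exists
  exact ⟨t, ht0, ht1, ht⟩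

theorem theorem5p1 {k : ℕ} {H X : Type*} [MeasurableSpace H] [MeasurableSpace X]
    (M : SemiparametricModel k H X)
    (θ₀ : EuclideanSpace ℝ (Fin k)) (hθ₀ : θ₀ ∈ M.Θ) (η₀ : H)
    (PiΘ : Measure (EuclideanSpace ℝ (Fin k))) [IsProbabilityMeasure PiΘ]
    (hPiΘ : PiΘ M.Θᶜ = 0) (hthick : ThickAt PiΘ θ₀)
    (PiH : Measure H) [IsProbabilityMeasure PiH]
    (hcont : ∀ᶠ n : ℕ in atTop, ∀ᵐ x ∂(sampleLaw (M.P θ₀ η₀) n),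
      ContinuousOn (fun h => M.localLR θ₀ η₀ PiH x h) {h | θ₀ + (√(n : ℝ))⁻¹ • h ∈ M.Θ})
    (l : X → EuclideanSpace ℝ (Fin k))
    (hl : MemLp l 2 (M.P θ₀ η₀)) (hl0 : ∫ x, l x ∂(M.P θ₀ η₀) = 0)
    (hI : IsUnit (infoMatrix (M.P θ₀ η₀) l).det)
    (hILAN : M.HasILAN θ₀ η₀ PiH l)
    (hrate : ∀ m : ℕ → ℝ, Tendsto m atTop atTop →
      ConvergesInProb (M.P θ₀ η₀)
        (fun n x => (M.localPosterior θ₀ PiΘ PiH x).real {h | ‖h‖ ≤ m n}) 1) :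
    ConvergesInProb (M.P θ₀ η₀)
      (fun n x => tvDistance (M.localPosterior θ₀ PiΘ PiH x)
        (multivariateGaussian (centring (M.P θ₀ η₀) l x) (infoMatrix (M.P θ₀ η₀) l)⁻¹)) 0 := by
  have := M.isProbabilityMeasure_P (η₀ := η₀) hθ₀
  have hpd := infoMatrix_posDef hl hI
  obtain ⟨f, hfm, -, rfl, hfc, hf0⟩ := hthick
  intro ε hε
  obtain ⟨t, ht0, ht1, htε⟩ := exists_pos_exp_div_one_sub_lt hε
  refine ENNReal.tendsto_nhds_zero.2 fun η hη => ?_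
  have hη3 : 0 < η / 3 := ENNReal.div_pos hη.ne' (by simp)
  obtain ⟨C, hC⟩ := boundedInProb_centring hl hl0 (η / 3) hη3
  obtain ⟨r, hr⟩ := exists_forall_le_multivariateGaussian_closedBall
    (infoMatrix (M.P θ₀ η₀) l)⁻¹ ht0
  obtain ⟨R₀, hR₀⟩ := SemiparametricModel.exists_radius_localPosterior hrate ht0 hη3
  -- `R₀` captures the posterior mass; `C + r` captures the Gaussian mass once `‖Δ̃_n‖ ≤ C`.
  obtain ⟨R, hR, hR_ge, hRC⟩ : ∃ R : ℝ, 0 ≤ R ∧ R₀ ≤ R ∧ C + r ≤ R :=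
    ⟨max 0 (max R₀ (C + r)), by simp, by simp, by simp⟩
  have hexp := (hILAN.tendsto_forall_closedBall hθ₀ hcont hl.1 hR ht0).eventually
    (gt_mem_nhds hη3)
  filter_upwards [hexp, hR₀ R hR_ge, eventually_ne_atTop 0,
    eventually_forall_closedBall_add_smul_mem
      (eventually_exp_mul_le_of_continuousAt hfc hf0 ht0) R] with n hn₁ hn₂ hn0 hnf
  -- Three exceptional events of probability at most `η / 3`: the expansion fails on the ball, the
  -- posterior leaks out of it, or `‖Δ̃_n‖ > C`. Off them the bound is deterministic.
  refine (measure_mono_ae ?_).trans ((measure_union_le _ _).trans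
    ((add_le_add ((measure_union_le _ _).trans (add_le_add hn₁.le hn₂)) (hC n)).trans
      (ENNReal.add_thirds η).le))
  filter_upwards [ae_sampleLaw_of_ae (M.ae_P_density_pos_lt_top (η₀ := η₀) hθ₀) n] with x hx hbad
  by_contra hcon
  obtain ⟨hnot₁₂, hnot₃⟩ := not_or.1 hcon
  obtain ⟨hnot₁, hnot₂⟩ := not_or.1 hnot₁₂
  obtain ⟨-, hs0, hs⟩ := not_not.1 hnot₁
  have hνB := not_not.1 hnot₂
  have hcen : ‖centring (M.P θ₀ η₀) l x‖ ≤ C := not_lt.1 fun h => hnot₃ h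
  obtain ⟨c, hc⟩ := M.exists_localPosterior_eq_smul_withDensity (θ₀ := θ₀) (η₀ := η₀)
    (f := fun θ => ENNReal.ofReal (f θ)) (by fun_prop) PiH hn0 x hx
  obtain ⟨b, hb, hb', hbN⟩ := exists_multivariateGaussian_eq_smul_withDensity hpd
    (mulVec_centring hI x)
  have hNB := hr (centring (M.P θ₀ η₀) l x) R (by linarith)
  have htv := tvDistance_le_of_nearly_proportional_density
    (K := M.localLR θ₀ η₀ PiH x 0 * ENNReal.ofReal (f θ₀))
    (M.localPosterior_univ_le_one _ PiH x) hc hbN hb hb'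
    (ENNReal.mul_ne_top hs0.ne ENNReal.ofReal_ne_top) Metric.isClosed_closedBall.measurableSet
    (Real.one_le_exp (by positivity : 0 ≤ 2 * t)) ht1 hνB hNB
    (fun h hh => (mul_ofReal_nearly_proportional (hs h hh) (hnf h hh)).1)
    (fun h hh => (mul_ofReal_nearly_proportional (hs h hh) (hnf h hh)).2)
  have htv0 : 0 ≤ tvDistance (M.localPosterior θ₀
      (volume.withDensity fun θ => ENNReal.ofReal (f θ)) PiH x)
      (multivariateGaussian (centring (M.P θ₀ η₀) l x) (infoMatrix (M.P θ₀ η₀) l)⁻¹) :=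
    Real.iSup_nonneg fun _ => abs_nonneg _
  have hlt : ε < |_ - 0| := hbad
  rw [sub_zero, abs_of_nonneg htv0] at hlt
  linarith
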